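/- Let $\mathcal C$ be an essentially small category, $J$ a Grothendieck topology on $\mathcal C$, and $P:\mathcal C^{\mathrm{op}}\to\mathbf{Set}$ a presheaf. Let $a:[\mathcal C^{\mathrm{op}},\mathbf{Set}]\to \mathrm{Sh}(\mathcal C,J)$ be the sheafification functor and $\eta_P:P\to a(P)$ the unit. Let $\int P$ be the category of elements of $P$: its objects are the pairs $(X,p)$ with $X\in\mathcal C$ and $p\in P(X)$, and its morphisms $(Y,q)\to(X,p)$ are the arrows $g:Y\to X$ of $\mathcal C$ with $P(g)(p)=q$. Let $\pi_P:\int P\to\mathcal C$ be the projection $(X,p)\mapsto X$, and let $J_P$ be the Grothendieck topology on $\int P$ whose covering sieves are exactly the sieves sent by $\pi_P$ to $J$-covering sieves. Then $\pi_P$ is a comorphism of sites $(\int P,J_P)\to(\mathcal C,J)$; let $C(\pi_P)_*:\mathrm{Sh}(\int P,J_P)\to\mathrm{Sh}(\mathcal C,J)$ be the direct image of the induced geometric morphism, i.e. the restriction to sheaves of the right Kan extension functor $\mathrm{Ran}_{\pi_P^{\mathrm{op}}}:[(\int P)^{\mathrm{op}},\mathbf{Set}]\to[\mathcal C^{\mathrm{op}},\mathbf{Set}]$.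 Let $$\textstyle\prod_{a(P)}:\mathrm{Sh}(\mathcal C,J)/a(P)\to\mathrm{Sh}(\mathcal C,J)$$ be the dependent product, i.e. the right adjoint of the functor $U\mapsto (a(P)\times U\to a(P))$. Let $$R^J_P:\mathrm{Sh}(\mathcal C,J)/a(P)\to \mathrm{Sh}(\textstyle\int P,J_P),\qquad R^J_P[h:H\to a(P)](X,p)=\{x\in H(X)\mid h_X(x)=(\eta_P)_X(p)\}.$$ Then $R^J_P$ is an equivalence of categories, and under it $\prod_{a(P)}$ corresponds to $C(\pi_P)_*$: for a quasi-inverse $L^J_P$ of $R^J_P$ there are natural isomorphisms $$C(\pi_P)_*\circ R^J_P\;\cong\;\textstyle\prod_{a(P)},\qquad C(\pi_P)_*\;\cong\;\textstyle\prod_{a(P)}\circ L^J_P .$$ -/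

import Mathlib

open CategoryTheory Opposite Limits

universe w v u

noncomputable section

namespace SliceSite

variable {C : Type u} [Category.{v} C]

/-- The category of elements `∫ P` of a presheaf `P : Cᵒᵖ ⥤ Type w`.  An object is a pair `(X, p)`
with `p ∈ P(X)`, and a morphism `(Y, q) ⟶ (X, p)` is a morphism `g : Y ⟶ X` of `C` with
`P(g)(p) = q` (this is the opposite of Mathlib's category of elements of the covariant functor
`P` on `Cᵒᵖ`). -/
abbrev El (P : Cᵒᵖ ⥤ Type w) : Type (max u w) := P.Elementsᵒᵖ

/-- The object `(X, p)` of `∫ P`. -/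
abbrev El.mk (P : Cᵒᵖ ⥤ Type w) (X : C) (p : P.obj (op X)) : El P :=
  op (P.elementsMk (op X) p)

/-- The projection `π_P : ∫ P ⥤ C`, `(X, p) ↦ X`. -/
abbrev proj (P : Cᵒᵖ ⥤ Type w) : El P ⥤ C := (CategoryOfElements.π P).leftOp

/-- Every morphism `g : Y ⟶ X` of `C` lifts to a morphism `(Y, P(g)(p)) ⟶ (X, p)` of `∫ P`. -/
def El.lift {P : Cᵒᵖ ⥤ Type w} (x : El P) {Y : C} (g : Y ⟶ (proj P).obj x) :
    El.mk P Y (P.map g.op x.unop.2) ⟶ x :=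
  Quiver.Hom.op (X := x.unop) ⟨g.op, rfl⟩

@[simp]
theorem El.proj_map_lift {P : Cᵒᵖ ⥤ Type w} (x : El P) {Y : C} (g : Y ⟶ (proj P).obj x) :
    (proj P).map (El.lift x g) = g := rfl

theorem El.hom_cases {P : Cᵒᵖ ⥤ Type w} {x : El P} {motive : ∀ z : El P, (z ⟶ x) → Prop}
    (h : ∀ (Y : C) (g : Y ⟶ (proj P).obj x), motive _ (El.lift x g)) (z : El P) (f : z ⟶ x) :
    motive z f := by
  obtain ⟨⟨⟨Y⟩, q⟩⟩ := z
  have key : ∀ (q' : P.obj (op Y)) (f' : El.mk P Y q' ⟶ x), motive _ f' := by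
    intro q' f'
    obtain ⟨g, hg, hf⟩ : ∃ g : Y ⟶ (proj P).obj x, P.map g.op x.unop.2 = q' ∧
      (proj P).map f' = g := ⟨_, f'.unop.2, rfl⟩
    subst hg
    have : f' = El.lift x g := (proj P).map_injective hf
    rw [this]
    exact h _ _
  exact key q f

theorem El.mem_pushforward_proj {P : Cᵒᵖ ⥤ Type w} {x : El P} (S : Sieve x) {Y : C}
    (g : Y ⟶ (proj P).obj x) :
    S.functorPushforward (proj P) g ↔ S (El.lift x g) := by
  constructor
  · rintro ⟨z, k, h, hk, rfl⟩
    revert h hk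
    refine El.hom_cases (motive := fun z k => ∀ (h : Y ⟶ (proj P).obj z), S k →
      S (El.lift x (h ≫ (proj P).map k))) ?_ z k
    intro Z k h hk
    let m : El.mk P Y (P.map (h ≫ k).op x.unop.2) ⟶ El.mk P Z (P.map k.op x.unop.2) :=
      Quiver.Hom.op ⟨h.op, (Functor.map_comp_apply P k.op h.op x.unop.2).symm⟩
    have : El.lift x (h ≫ k) = m ≫ El.lift x k := rfl
    rw [El.proj_map_lift, this]
    exact S.downward_closed hk _
  · intro h
    exact ⟨_, El.lift x g, 𝟙 _, h, (Category.id_comp g).symm⟩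

/-- The topology `J_P` on `∫ P`: a sieve covers if and only if its image under
`π_P : ∫ P ⥤ C` is a `J`-covering sieve. -/
def topology (J : GrothendieckTopology C) (P : Cᵒᵖ ⥤ Type w) : GrothendieckTopology (El P) where
  sieves x := {S | S.functorPushforward (proj P) ∈ J ((proj P).obj x)}
  top_mem' x := by
    have : (⊤ : Sieve x).functorPushforward (proj P) = ⊤ := by
      ext Y g
      simp
    simp only [Set.mem_ofPred_eq, this, J.top_mem]
  pullback_stable' x y S f hS := by
    refine J.superset_covering ?_ (J.pullback_stable ((proj P).map f) hS)
    intro Z g hg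
    refine (El.mem_pushforward_proj _ _).2 ?_
    revert g hg
    refine El.hom_cases (motive := fun y f => ∀ (g : Z ⟶ (proj P).obj y),
      (S.functorPushforward (proj P)) (g ≫ (proj P).map f) → S (El.lift y g ≫ f)) ?_ y f
    intro Y k g hg
    let m : El.mk P Z (P.map g.op (P.map k.op x.unop.2)) ⟶ El.mk P Z (P.map (g ≫ k).op x.unop.2) :=
      Quiver.Hom.op ⟨𝟙 _, (Functor.map_id_apply P _ _).trans
        (Functor.map_comp_apply P k.op g.op x.unop.2)⟩
    have hm : El.lift _ g ≫ El.lift x k = m ≫ El.lift x (g ≫ k) :=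
      Quiver.Hom.unop_inj (Subtype.ext (Category.comp_id _).symm)
    rw [hm]
    exact S.downward_closed ((El.mem_pushforward_proj S _).1 hg) _
  transitive' x S hS R hR := by
    refine J.transitive hS _ ?_
    intro Y g hg
    refine J.superset_covering ?_ (hR ((El.mem_pushforward_proj S g).1 hg))
    rintro Z h ⟨z, k, l, hk, rfl⟩
    exact ⟨z, k ≫ El.lift x g, l, hk, Category.assoc _ _ _⟩

/-- `π_P` is a comorphism of sites `(∫ P, J_P) → (C, J)`. -/
instance proj_isCocontinuous (J : GrothendieckTopology C) (P : Cᵒᵖ ⥤ Type w) :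
    (proj P).IsCocontinuous (topology J P) J where
  cover_lift {x} S hS := by
    refine J.superset_covering ?_ hS
    intro Y g hg
    exact (El.mem_pushforward_proj _ _).2 hg

section Existence

variable [EssentiallySmall.{w} C]

instance hasSheafify (J : GrothendieckTopology C) : HasSheafify J (Type w) :=
  hasSheafifyEssentiallySmallSite J (Type w)

instance hasRan (P : Cᵒᵖ ⥤ Type w) (F : (El P)ᵒᵖ ⥤ Type w) :
    (proj P).op.HasPointwiseRightKanExtension F := by
  intro X
  have : HasLimitsOfShape (StructuredArrow X (proj P).op) (Type w) :=
    hasLimitsOfShape_of_essentiallySmall.{w} _ _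
  infer_instance

theorem isLeftAdjoint_star_of_closed {E : Type*} [Category* E] [CartesianMonoidalCategory E]
    [HasPullbacks E] [HasBinaryProducts E] (X : E) [MonoidalClosed E] :
    (Over.star X).IsLeftAdjoint := by
  let : BraidedCategory E := .ofCartesianMonoidalCategory
  let := ChosenPullbacksAlong.ofHasPullbacksAlong (f := curryRightUnitorHom X)
  exact ((Over.toOverSectionsAdj X).ofNatIsoLeft
    ((Over.forgetAdjStar X).rightAdjointUniq (forgetAdjToOver X)).symm).isLeftAdjoint

/-- The functor `X^* : Sh(C, J) ⥤ Sh(C, J)/X`, `U ↦ (X × U → X)`, has a right adjoint. -/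
instance isLeftAdjoint_star (J : GrothendieckTopology C) (X : Sheaf J (Type w)) :
    (Over.star X).IsLeftAdjoint := by
  let e : (SmallModel.{w} Cᵒᵖ) ⥤ Type w ≌ Cᵒᵖ ⥤ Type w :=
    Functor.asEquivalence ((Functor.whiskeringLeft _ _ _).obj (equivSmallModel.{w} Cᵒᵖ).functor)
  let : MonoidalClosed (Cᵒᵖ ⥤ Type w) := cartesianClosedOfEquiv e
  have b : MonoidalClosed (Sheaf J (Type w)) := inferInstance
  exact @isLeftAdjoint_star_of_closed _ _ _ _ _ X b

end Existence

/-- For `a : P ⟶ Q` and `h : H ⟶ Q`, the presheaf `(X, p) ↦ {x ∈ H(X) | h_X(x) = a_X(p)}` on `∫ P`;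
restriction along `g` is the restriction `H(g)`. -/
def fibre {P Q : Cᵒᵖ ⥤ Type w} (a : P ⟶ Q) : Over Q ⥤ ((El P)ᵒᵖ ⥤ Type w) where
  obj h :=
    { obj z := {x : h.left.obj z.unop.unop.1 // h.hom.app _ x = a.app _ z.unop.unop.2}
      map {z z'} f := ↾fun x => ⟨h.left.map f.unop.unop.val x.1, by
        have h₁ := NatTrans.naturality_apply h.hom f.unop.unop.val x.1
        have h₂ := NatTrans.naturality_apply a f.unop.unop.val z.unop.unop.2
        have h₃ := f.unop.unop.2
        rw [x.2] at h₁
        exact h₁.trans (h₂.symm.trans (congrArg _ h₃))⟩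
      map_id z := by
        ext x
        exact (Functor.map_id_apply h.left _ x.1)
      map_comp f g := by
        ext x
        exact (Functor.map_comp_apply h.left _ _ x.1) }
  map {h h'} φ :=
    { app z := ↾fun x => ⟨φ.left.app _ x.1, by
        have h₁ := ConcreteCategory.congr_hom (NatTrans.congr_app (Over.w φ) z.unop.unop.1) x.1
        exact h₁.trans x.2⟩
      naturality z z' f := by
        ext x
        exact (NatTrans.naturality_apply φ.left f.unop.unop.val x.1) }
  map_id h := by
    ext z x
    rfl
  map_comp φ ψ := by
    ext z x
    rfl

/-- If `Q` and `H` are `J`-sheaves then the presheaf `(X, p) ↦ {x ∈ H(X) | h_X(x) = a_X(p)}` is a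
`J_P`-sheaf. -/
theorem fibre_isSheaf (J : GrothendieckTopology C) {P Q : Cᵒᵖ ⥤ Type w} (a : P ⟶ Q) (h : Over Q)
    (hQ : Presheaf.IsSheaf J Q) (hH : Presheaf.IsSheaf J h.left) :
    Presheaf.IsSheaf (topology J P) ((fibre a).obj h) := by
  rw [isSheaf_iff_isSheaf_of_type] at *
  intro x S hS ξ hξ
  let S' : Sieve ((proj P).obj x) := S.functorPushforward (proj P)
  have hS' : S' ∈ J _ := hS
  have mem : ∀ {Y : C} {g : Y ⟶ (proj P).obj x}, S' g → S (El.lift x g) :=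
    fun hg => (El.mem_pushforward_proj S _).1 hg
  let ζ : Presieve.FamilyOfElements h.left S'.arrows := fun Y g hg => (ξ (El.lift x g) (mem hg)).1
  have hζ : ζ.Compatible := by
    intro Y₁ Y₂ Z g₁ g₂ f₁ f₂ h₁ h₂ e
    let m₁ : El.mk P Z (P.map (g₁ ≫ f₁).op x.unop.2) ⟶ El.mk P Y₁ (P.map f₁.op x.unop.2) :=
      Quiver.Hom.op ⟨g₁.op, (Functor.map_comp_apply P f₁.op g₁.op x.unop.2).symm⟩
    let m₂ : El.mk P Z (P.map (g₁ ≫ f₁).op x.unop.2) ⟶ El.mk P Y₂ (P.map f₂.op x.unop.2) :=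
      Quiver.Hom.op ⟨g₂.op, by
        rw [e]; exact (Functor.map_comp_apply P f₂.op g₂.op x.unop.2).symm⟩
    exact congrArg Subtype.val (hξ m₁ m₂ (mem h₁) (mem h₂) ((proj P).map_injective e))
  obtain ⟨t, ht, htu⟩ := hH S' hS' ζ hζ
  have htp : h.hom.app _ t = a.app _ x.unop.2 := by
    refine (hQ S' hS').isSeparatedFor.ext fun Y g hg => ?_
    have h₁ := NatTrans.naturality_apply h.hom g.op t
    have h₂ := NatTrans.naturality_apply a g.op x.unop.2
    have h₃ := ht g hg
    have h₄ : h.hom.app _ (ζ g hg) = a.app _ (P.map g.op x.unop.2) :=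
      (ξ (El.lift x g) (mem hg)).2
    rw [← h₃] at h₄
    exact h₁.symm.trans (h₄.trans h₂)
  refine ⟨⟨t, htp⟩, ?_, ?_⟩
  · refine fun z f => El.hom_cases (motive := fun z f => ∀ hf : S f,
      ((fibre a).obj h).map f.op ⟨t, htp⟩ = ξ f hf) ?_ z f
    intro Y g hg
    exact Subtype.ext (ht g ((El.mem_pushforward_proj S _).2 hg))
  · rintro ⟨t', ht'⟩ hh
    refine Subtype.ext (htu t' fun Y g hg => ?_)
    exact congrArg Subtype.val (hh (El.lift x g) (mem hg))

variable [EssentiallySmall.{w} C]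

/-- The functor `R_P^J : Sh(C, J)/a(P) ⥤ Sh(∫ P, J_P)`,
`R_P^J[h](X, p) = {x ∈ H(X) | h_X(x) = (η_P)_X(p)}` for `h : H ⟶ a(P)`, where `a` is
sheafification and `η_P : P ⟶ a(P)` is the unit. -/
def R (J : GrothendieckTopology C) (P : Cᵒᵖ ⥤ Type w) :
    Over ((presheafToSheaf J (Type w)).obj P) ⥤ Sheaf (topology J P) (Type w) :=
  ObjectProperty.lift _ (Over.post (sheafToPresheaf J (Type w)) ⋙ fibre (toSheafify J P))
    (fun h => fibre_isSheaf J _ _ ((presheafToSheaf J (Type w)).obj P).property h.left.property)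

/-- The direct image `C(π_P)_* : Sh(∫ P, J_P) ⥤ Sh(C, J)` of the geometric morphism induced by the
comorphism of sites `π_P`: the restriction to sheaves of the right Kan extension along
`π_Pᵒᵖ`. -/
abbrev directImage (J : GrothendieckTopology C) (P : Cᵒᵖ ⥤ Type w) :
    Sheaf (topology J P) (Type w) ⥤ Sheaf J (Type w) :=
  (proj P).sheafPushforwardCocontinuous (Type w) (topology J P) J

/-- The dependent product `∏_X : Sh(C, J)/X ⥤ Sh(C, J)`: the right adjoint of the functor
`X^* : Sh(C, J) ⥤ Sh(C, J)/X`, `U ↦ (X × U → X)`. -/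
abbrev dependentProduct (J : GrothendieckTopology C) (X : Sheaf J (Type w)) :
    Over X ⥤ Sheaf J (Type w) :=
  (Over.star X).rightAdjoint

end SliceSite

end

noncomputable section

namespace SliceSite

variable {C : Type u} [Category.{v} C]

instance proj_isContinuous (J : GrothendieckTopology C) (P : Cᵒᵖ ⥤ Type w) :
    (proj P).IsContinuous (topology J P) J := by
  refine Functor.isContinuous_of_coverPreserving ⟨?_⟩ ⟨fun hS => hS⟩
  intro F x T ξ hξ Y₁ Y₂ Z f₁ f₂ g₁ g₂ hg₁ hg₂ e
  let m : El.mk P Z (P.map f₂.op Y₂.unop.2) ⟶ Y₁ :=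
    Quiver.Hom.op (X := Y₁.unop) ⟨f₁.op, by
      refine (congrArg _ g₁.unop.2.symm).trans (Eq.trans ?_ (congrArg _ g₂.unop.2))
      refine (Functor.map_comp_apply P _ _ _).symm.trans
        (Eq.trans ?_ (Functor.map_comp_apply P _ _ _))
      exact ConcreteCategory.congr_hom (congrArg (fun k => P.map k.op) e) x.unop.2⟩
  exact hξ m (El.lift Y₂ f₂) hg₁ hg₂ ((proj P).map_injective e)

theorem sigma_exists_eq_mk {α : Type*} {β : α → Type*} {s : Sigma β} {q : α} (h : s.1 = q) :
    ∃ t, s = ⟨q, t⟩ := by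
  subst h
  exact ⟨s.2, rfl⟩

section Total

variable {P : Cᵒᵖ ⥤ Type w}

theorem sigma_mk_map_lift (G : (El P)ᵒᵖ ⥤ Type w) {z x : El P} (f : z ⟶ x) (s : G.obj (op x)) :
    (⟨P.map ((proj P).map f).op x.unop.2, G.map (El.lift x ((proj P).map f)).op s⟩ :
      Σ p : P.obj (op ((proj P).obj z)), G.obj (op (El.mk P _ p))) =
      ⟨z.unop.2, G.map f.op s⟩ := by
  exact El.hom_cases (motive := fun z f =>
    (⟨P.map ((proj P).map f).op x.unop.2, G.map (El.lift x ((proj P).map f)).op s⟩ :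
      Σ p : P.obj (op ((proj P).obj z)), G.obj (op (El.mk P _ p))) =
      ⟨z.unop.2, G.map f.op s⟩) (fun _ _ => rfl) z f

/-- The presheaf `X ↦ Σ p ∈ P(X), G(X, p)` on `C` associated with a presheaf `G` on `∫ P`. -/
def total (G : (El P)ᵒᵖ ⥤ Type w) : Cᵒᵖ ⥤ Type w where
  obj X := Σ p : P.obj X, G.obj (op (El.mk P X.unop p))
  map {X Y} g := ↾fun s => ⟨P.map g s.1, G.map (El.lift (El.mk P X.unop s.1) g.unop).op s.2⟩
  map_id X := by
    refine ConcreteCategory.hom_ext _ _ fun ⟨p, s⟩ => ?_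
    exact (sigma_mk_map_lift G (𝟙 (El.mk P X.unop p)) s).trans
      (congrArg (Sigma.mk p) (Functor.map_id_apply G _ s))
  map_comp {X Y Z} f g := by
    refine ConcreteCategory.hom_ext _ _ fun ⟨p, s⟩ => ?_
    let l := El.lift (El.mk P X.unop p) f.unop
    exact (sigma_mk_map_lift G (El.lift (El.mk P Y.unop (P.map f p)) g.unop ≫ l) s).trans
      (congrArg (Sigma.mk _) (Functor.map_comp_apply G _ _ s))

/-- The projection `(p, s) ↦ p`. -/
def totalProj (G : (El P)ᵒᵖ ⥤ Type w) : total G ⟶ P where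
  app X := ↾fun s => s.1

/-- The morphism of presheaves on `C` induced by a morphism of presheaves on `∫ P`. -/
def totalMap {G G' : (El P)ᵒᵖ ⥤ Type w} (α : G ⟶ G') : total G ⟶ total G' where
  app X := ↾fun s => ⟨s.1, α.app _ s.2⟩
  naturality X Y g := by
    refine ConcreteCategory.hom_ext _ _ fun ⟨p, s⟩ => ?_
    exact congrArg (Sigma.mk _) (NatTrans.naturality_apply α _ s)

variable {Q : Cᵒᵖ ⥤ Type w} (a : P ⟶ Q)

/-- The projection `P ×_Q H ⟶ H`. -/
def totalFibre (h : Over Q) : total ((fibre a).obj h) ⟶ h.left where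
  app X := ↾fun s => s.2.1

variable {a}

theorem totalFibre_ext {h : Over Q} {X : Cᵒᵖ} {s t : (total ((fibre a).obj h)).obj X}
    (h₁ : s.1 = t.1) (h₂ : s.2.1 = t.2.1) : s = t := by
  obtain ⟨p, x, hx⟩ := s
  obtain ⟨q, y, hy⟩ := t
  obtain rfl : p = q := h₁
  obtain rfl : x = y := h₂
  rfl

instance isLocallyInjective_totalFibre (J : GrothendieckTopology C)
    [Presheaf.IsLocallyInjective J a] (h : Over Q) :
    Presheaf.IsLocallyInjective J (totalFibre a h) where
  equalizerSieve_mem {X} s t hst := by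
    have hst : s.2.1 = t.2.1 := hst
    refine J.superset_covering ?_ (Presheaf.equalizerSieve_mem J a s.1 t.1
      (s.2.2.symm.trans ((congrArg _ hst).trans t.2.2)))
    intro Y g hg
    exact totalFibre_ext hg (congrArg (h.left.map g.op) hst)

instance isLocallySurjective_totalFibre (J : GrothendieckTopology C)
    [Presheaf.IsLocallySurjective J a] (h : Over Q) :
    Presheaf.IsLocallySurjective J (totalFibre a h) where
  imageSieve_mem {X} x := by
    refine J.superset_covering ?_ (Presheaf.imageSieve_mem J a (U := op X) (h.hom.app _ x))
    rintro Y g ⟨p, hp⟩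
    exact ⟨⟨p, h.left.map g.op x, (NatTrans.naturality_apply h.hom g.op x).trans hp.symm⟩, rfl⟩

end Total

theorem existsUnique_prod_section (J : GrothendieckTopology C) {X U : Sheaf J (Type w)}
    {Y : Cᵒᵖ} (x : X.obj.obj Y)
    (y : U.obj.obj Y) : ∃! z : (X ⨯ U).obj.obj Y,
      (prod.fst : X ⨯ U ⟶ X).hom.app Y z = x ∧ (prod.snd : X ⨯ U ⟶ U).hom.app Y z = y := by
  let Γ : Sheaf J (Type w) ⥤ Type w := sheafToPresheaf J (Type w) ⋙ (evaluation _ _).obj Y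
  have l := mapIsLimitOfPreservesOfIsLimit Γ _ _ (prodIsProd X U)
  let f (t : Γ.obj (X ⨯ U)) : PUnit.{w + 1} ⟶ Γ.obj (X ⨯ U) := ↾fun _ => t
  obtain ⟨z, h₁, h₂⟩ := BinaryFan.IsLimit.lift' l (↾fun _ : PUnit.{w + 1} => x) (↾fun _ => y)
  refine ⟨z PUnit.unit, ⟨ConcreteCategory.congr_hom h₁ PUnit.unit,
    ConcreteCategory.congr_hom h₂ PUnit.unit⟩, fun t ⟨h₃, h₄⟩ => ?_⟩
  have : f t = z := BinaryFan.IsLimit.hom_ext l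
    (Eq.trans (ConcreteCategory.hom_ext _ _ fun _ => h₃) h₁.symm)
    (Eq.trans (ConcreteCategory.hom_ext _ _ fun _ => h₄) h₂.symm)
  exact ConcreteCategory.congr_hom this PUnit.unit

variable [EssentiallySmall.{w} C] (J : GrothendieckTopology C) (P : Cᵒᵖ ⥤ Type w)

instance wEqualsLocallyBijective : J.WEqualsLocallyBijective (Type w) := by
  have (X : Cᵒᵖ) : HasLimitsOfShape (StructuredArrow X (equivSmallModel.{w} C).inverse.op)
      (Type w) := hasLimitsOfShape_of_essentiallySmall.{w} _ _
  exact GrothendieckTopology.WEqualsLocallyBijective.ofEssentiallySmall J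

/-- The object of presheaves over `a(P)` underlying an object of `Sh(C, J)/a(P)`. -/
abbrev overPresheaf {J} {P : Cᵒᵖ ⥤ Type w} (h : Over ((presheafToSheaf J (Type w)).obj P)) :
    Over (sheafify J P) :=
  (Over.post (sheafToPresheaf J (Type w))).obj h

theorem W_totalFibre (h : Over ((presheafToSheaf J (Type w)).obj P)) :
    J.W (totalFibre (toSheafify J P) (overPresheaf h)) :=
  J.W_of_isLocallyBijective _

instance faithful_R : (R J P).Faithful where
  map_injective {h h'} f₁ f₂ hf := by
    refine Over.OverMorphism.ext (Sheaf.hom_ext ?_)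
    refine (W_totalFibre J P h _ h'.left.property).1 ?_
    ext X ⟨p, x⟩
    exact congrArg Subtype.val (ConcreteCategory.congr_hom
      (NatTrans.congr_app (congrArg (sheafToPresheaf _ _).map hf) (op (El.mk P X.unop p))) x)

instance full_R : (R J P).Full where
  map_surjective {h h'} α := by
    obtain ⟨φ, hφ⟩ := (W_totalFibre J P h _ h'.left.property).2
      (totalMap α.hom ≫ totalFibre (toSheafify J P) (overPresheaf h'))
    have hw : φ ≫ h'.hom.hom = h.hom.hom := by
      refine (W_totalFibre J P h _ ((presheafToSheaf J (Type w)).obj P).property).1 ?_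
      refine (Category.assoc _ _ _).symm.trans ((congrArg (· ≫ h'.hom.hom) hφ).trans ?_)
      ext X ⟨p, x⟩
      exact (α.hom.app (op (El.mk P X.unop p)) x).2.trans x.2.symm
    refine ⟨Over.homMk ⟨φ⟩ (Sheaf.hom_ext hw), Sheaf.hom_ext ?_⟩
    ext z x
    refine Subtype.ext ?_
    exact ConcreteCategory.congr_hom (NatTrans.congr_app hφ (op z.unop.unop.1.unop))
      ⟨z.unop.unop.2, x⟩

/-- The object `a(Σ_p G(-, p)) ⟶ a(P)` of `Sh(C, J)/a(P)` associated with a presheaf `G`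
on `∫ P`. -/
abbrev sheafifyTotal {P : Cᵒᵖ ⥤ Type w} (G : (El P)ᵒᵖ ⥤ Type w) :
    Over ((presheafToSheaf J (Type w)).obj P) :=
  Over.mk ((presheafToSheaf J (Type w)).map (totalProj G))

theorem sheafifyTotal_hom_app {P : Cᵒᵖ ⥤ Type w} (G : (El P)ᵒᵖ ⥤ Type w) {X : Cᵒᵖ}
    (s : (total G).obj X) :
    (sheafifyTotal J G).hom.hom.app X ((toSheafify J (total G)).app X s) =
      (toSheafify J P).app X s.1 :=
  (ConcreteCategory.congr_hom (NatTrans.congr_app (toSheafify_naturality J (totalProj G)) X)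
    s).symm

/-- The canonical morphism from `G` to the presheaf of fibres of `a(Σ_p G(-, p)) ⟶ a(P)`. -/
def toFibreSheafifyTotal {P : Cᵒᵖ ⥤ Type w} (G : (El P)ᵒᵖ ⥤ Type w) :
    G ⟶ ((R J P).obj (sheafifyTotal J G)).obj where
  app z := ↾fun s => ⟨(toSheafify J (total G)).app z.unop.unop.1 ⟨z.unop.unop.2, s⟩,
    sheafifyTotal_hom_app J G _⟩
  naturality z z' f := by
    refine ConcreteCategory.hom_ext _ _ fun s => Subtype.ext ?_
    refine Eq.trans ?_ (NatTrans.naturality_apply (toSheafify J (total G)) f.unop.unop.1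
      ⟨z.unop.unop.2, s⟩)
    exact congrArg _ (sigma_mk_map_lift G f.unop s).symm

instance isLocallyInjective_toFibreSheafifyTotal {P : Cᵒᵖ ⥤ Type w} (G : (El P)ᵒᵖ ⥤ Type w) :
    Presheaf.IsLocallyInjective (topology J P) (toFibreSheafifyTotal J G) where
  equalizerSieve_mem {z} s t hst := by
    let σ (s : G.obj z) : (total G).obj z.unop.unop.1 := ⟨z.unop.unop.2, s⟩
    have hst : (toSheafify J (total G)).app _ (σ s) = (toSheafify J (total G)).app _ (σ t) :=
      congrArg Subtype.val hst
    refine J.superset_covering ?_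
      (Presheaf.equalizerSieve_mem J (toSheafify J (total G)) (σ s) (σ t) hst)
    intro Y g hg
    exact (El.mem_pushforward_proj _ _).2 (eq_of_heq (Sigma.mk.inj hg).2)

instance isLocallySurjective_toFibreSheafifyTotal {P : Cᵒᵖ ⥤ Type w} (G : (El P)ᵒᵖ ⥤ Type w) :
    Presheaf.IsLocallySurjective (topology J P) (toFibreSheafifyTotal J G) where
  imageSieve_mem {z} x := by
    refine J.transitive (Presheaf.imageSieve_mem J (toSheafify J (total G))
      (U := z.unop.1) x.1) _ ?_
    rintro Y g ⟨⟨p, s⟩, hs⟩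
    have hp : (toSheafify J P).app _ p = (toSheafify J P).app _ (P.map g.op z.unop.2) := by
      rw [← sheafifyTotal_hom_app J G ⟨p, s⟩, hs]
      refine (NatTrans.naturality_apply (sheafifyTotal J G).hom.hom g.op x.1).trans ?_
      rw [NatTrans.naturality_apply (toSheafify J P) g.op z.unop.2]
      exact congrArg _ x.2
    refine J.superset_covering ?_ (Presheaf.equalizerSieve_mem J (toSheafify J P) _ _ hp)
    intro Z k hk
    refine (El.mem_pushforward_proj _ _).2 ?_
    obtain ⟨t, ht⟩ : ∃ t, (total G).map k.op ⟨p, s⟩ = ⟨P.map (k ≫ g).op z.unop.2, t⟩ :=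
      sigma_exists_eq_mk (β := fun p => G.obj (op (El.mk P Z p)))
        (hk.trans (Functor.map_comp_apply P g.op k.op z.unop.2).symm)
    refine ⟨t, Subtype.ext ?_⟩
    refine (congrArg ((toSheafify J (total G)).app _) ht.symm).trans ?_
    refine (NatTrans.naturality_apply (toSheafify J (total G)) k.op _).trans ?_
    refine (congrArg _ hs).trans ?_
    exact (Functor.map_comp_apply (sheafify J (total G)) g.op k.op x.1).symm

instance essSurj_R : (R J P).EssSurj where
  mem_essImage G := by
    let θ : G ⟶ (R J P).obj (sheafifyTotal J G.obj) := ⟨toFibreSheafifyTotal J G.obj⟩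
    have h₁ : Sheaf.IsLocallyInjective θ := isLocallyInjective_toFibreSheafifyTotal J G.obj
    have h₂ : Sheaf.IsLocallySurjective θ := isLocallySurjective_toFibreSheafifyTotal J G.obj
    have : IsIso θ := (Sheaf.isLocallyBijective_iff_isIso θ).1 ⟨h₁, h₂⟩
    exact ⟨_, ⟨(asIso θ).symm⟩⟩

instance isEquivalence_R : (R J P).IsEquivalence where

/-- The component at `U` of the comparison between `R_P^J(a(P) × U)` and `U ∘ π_P`. -/
def starCompRApp (U : Sheaf J (Type w)) :
    (R J P).obj ((Over.star ((presheafToSheaf J (Type w)).obj P)).obj U) ⟶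
      ((proj P).sheafPushforwardContinuous (Type w) (topology J P) J).obj U where
  hom :=
    { app z := ↾fun x => ((Over.forgetAdjStar _).counit.app U).hom.app z.unop.unop.1 x.1
      naturality z z' f := by
        refine ConcreteCategory.hom_ext _ _ fun x => ?_
        exact NatTrans.naturality_apply ((Over.forgetAdjStar _).counit.app U).hom
          f.unop.unop.1 x.1 }

instance isIso_starCompRApp (U : Sheaf J (Type w)) : IsIso (starCompRApp J P U) := by
  rw [← isIso_iff_of_reflects_iso _ (sheafToPresheaf _ _), NatTrans.isIso_iff_isIso_app]
  intro z
  rw [isIso_iff_bijective, Function.bijective_iff_existsUnique]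
  intro y
  obtain ⟨t, ⟨h₁, h₂⟩, h₃⟩ := existsUnique_prod_section J
    ((toSheafify J P).app z.unop.unop.1 z.unop.unop.2) y
  have e : (Over.forgetAdjStar ((presheafToSheaf J (Type w)).obj P)).counit.app U = prod.snd :=
    Over.forgetAdjStar_counit_app _ _
  have e' : ((Over.star ((presheafToSheaf J (Type w)).obj P)).obj U).hom = prod.fst :=
    (Over.star_obj_hom _ _).trans (prod.lift_fst _ _)
  have hf (t) : ((Over.star ((presheafToSheaf J (Type w)).obj P)).obj U).hom.hom.app _ t =
      (prod.fst : (presheafToSheaf J (Type w)).obj P ⨯ U ⟶ _).hom.app z.unop.unop.1 t :=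
    congrArg (fun k : (presheafToSheaf J (Type w)).obj P ⨯ U ⟶ _ => k.hom.app _ t) e'
  have hs (t) :
      ((Over.forgetAdjStar ((presheafToSheaf J (Type w)).obj P)).counit.app U).hom.app _ t =
      (prod.snd : (presheafToSheaf J (Type w)).obj P ⨯ U ⟶ _).hom.app z.unop.unop.1 t :=
    congrArg (fun k : (presheafToSheaf J (Type w)).obj P ⨯ U ⟶ _ => k.hom.app _ t) e
  exact ⟨⟨t, (hf t).trans h₁⟩, (hs t).trans h₂, fun ⟨t', ht'⟩ h => Subtype.ext
    (h₃ t' ⟨(hf t').symm.trans ht', (hs t').symm.trans h⟩)⟩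

/-- `R_P^J` sends `a(P) × U ⟶ a(P)` to `U ∘ π_P`. -/
def starCompR : Over.star ((presheafToSheaf J (Type w)).obj P) ⋙ R J P ≅
    (proj P).sheafPushforwardContinuous (Type w) (topology J P) J :=
  NatIso.ofComponents (fun U => asIso (starCompRApp J P U)) fun {U V} f => by
    refine Sheaf.hom_ext ?_
    ext z x
    exact ConcreteCategory.congr_hom (NatTrans.congr_app (congrArg (sheafToPresheaf _ _).map
      ((Over.forgetAdjStar ((presheafToSheaf J (Type w)).obj P)).counit.naturality f))
        z.unop.unop.1) x.1

/-- Under `R_P^J`, the direct image `C(π_P)_*` corresponds to the dependent product along `a(P)`. -/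
def directImageIso : directImage J P ≅
    (R J P).inv ⋙ dependentProduct J ((presheafToSheaf J (Type w)).obj P) :=
  ((proj P).sheafAdjunctionCocontinuous (Type w) (topology J P) J).rightAdjointUniq
    (((Adjunction.ofIsLeftAdjoint (Over.star ((presheafToSheaf J (Type w)).obj P))).comp
      (R J P).asEquivalence.toAdjunction).ofNatIsoLeft (starCompR J P))

end SliceSite

end

theorem mainTheorem8 {C : Type u} [Category.{v} C] [EssentiallySmall.{w} C]
    (J : GrothendieckTopology C) (P : Cᵒᵖ ⥤ Type w) :
    ∃ e : Over ((presheafToSheaf J (Type w)).obj P) ≌ Sheaf (SliceSite.topology J P) (Type w),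
      e.functor = SliceSite.R J P ∧
      Nonempty (e.functor ⋙ SliceSite.directImage J P ≅
        SliceSite.dependentProduct J ((presheafToSheaf J (Type w)).obj P)) ∧
      Nonempty (SliceSite.directImage J P ≅
        e.inverse ⋙ SliceSite.dependentProduct J ((presheafToSheaf J (Type w)).obj P)) := by
  let e := (SliceSite.R J P).asEquivalence
  let i : SliceSite.directImage J P ≅ e.inverse ⋙ SliceSite.dependentProduct J _ :=
    SliceSite.directImageIso J P
  exact ⟨e, rfl, ⟨Functor.isoWhiskerLeft e.functor i ≪≫ e.funInvIdAssoc _⟩, ⟨i⟩⟩
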